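/- Let $V$ be a $3$-dimensional complex vector space with a hermitian form $\langle-,-\rangle$ (linear in the first argument) of signature $++-$. Call points $[v]\in\mathbb P_{\mathbb C}V$ with $\langle v,v\rangle<0$ negative. For a $\mathbb C$-linear map $h:V\to V$ let $h^*$ be its adjoint with respect to $\langle-,-\rangle$ and put $B_h:=\{p\in\mathbb P_{\mathbb C}V\mid\langle hp,p\rangle=0\}$. If $h$ has rank $2$, $h^*=h$, $\operatorname{tr}h=0$ and $B_h\ne\mathbb P_{\mathbb C}\ker h$, then $B_h$ is called the bisector given by $h$. A family of bisectors is a real linear subspace $W\subset\operatorname{Lin}_{\mathbb C}(V,V)$ such that $\operatorname{tr}h=0$ and $h^*=h$ for all $h\in W$, the base $B_W:=\bigcap_{h\in W}B_h$ contains a negative point, and $W$ is the real span of $D_W:=\{h\in W\mid\det h=0\}$. It is elliptic if $D_W\neq W$ and $\dim_{\mathbb R}W=3$; then the image $E_W$ of $D_W$ in $\mathbb P_{\mathbb R}W$ is the real plane cubic with equation $\det=0$, and it is called irreducible if $\det|_W$ is an irreducible real polynomial in linear coordinates on $W$. An elliptic family $W$ is called equitant if there are $\sigma\in\{1,-1,0\}$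 and $p_1,\dots,p_4\in V$, any three of them $\mathbb C$-linearly independent, with $\langle p_i,p_i\rangle=\sigma$ for all $i$, such that $|\langle q,p_i\rangle|=1$ for all $i$ and some $q\in V$ with $\langle q,q\rangle<0$, and $$W=\Big\{\sum_{i=1}^4r_i\langle-,p_i\rangle p_i\ \Big|\ r_i\in\mathbb R,\ \sum_{i=1}^4r_i=0\Big\}.$$ Theorem. Let $W$ be an equitant elliptic family of bisectors with irreducible $E_W$ and let $B\subset B_W$ be infinite. Then $$W=\big\{h\in\operatorname{Lin}_{\mathbb C}(V,V)\ \big|\ h^*=h,\ \langle hb,b\rangle=0\text{ for all }b\in B\big\}.$$ Consequently, a $\mathbb C$-linear map $h:V\to V$ gives a bisector $B_h$ containing $B$ if and only if $0\ne h\in W$ and the class of $h$ in $\mathbb P_{\mathbb R}W$ lies on $E_W$. -/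

import Mathlib

open scoped LinearAlgebra.Projectivization ComplexConjugate

namespace CHyp

noncomputable section

variable {V : Type*} [AddCommGroup V] [Module ℂ V]

/-- `H` is a hermitian form on a `3`-dimensional complex space `V`, linear in the first argument and
conjugate-linear in the second one, of signature `++-`: there is an orthonormal basis for it. -/
def HasSignature21 (H : V →ₗ[ℂ] V →ₗ⋆[ℂ] ℂ) : Prop :=
  ∃ e : Module.Basis (Fin 3) ℂ V, ∀ i j : Fin 3, H (e i) (e j) = if i = j then ![1, 1, -1] i else 0

/-- The holomorphic ball: the negative points of the complex projective plane. -/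
def ball (H : V →ₗ[ℂ] V →ₗ⋆[ℂ] ℂ) : Set (ℙ ℂ V) :=
  {p | (H p.rep p.rep).re < 0}

/-- `B_h`, the set of points `p` of the complex projective plane with `⟨hp, p⟩ = 0`. -/
def locus (H : V →ₗ[ℂ] V →ₗ⋆[ℂ] ℂ) (h : V →ₗ[ℂ] V) : Set (ℙ ℂ V) :=
  {p | H (h p.rep) p.rep = 0}

/-- The condition `⟨hp, p⟩ = 0` does not depend on the representative. -/
theorem mk_mem_locus (H : V →ₗ[ℂ] V →ₗ⋆[ℂ] ℂ) (h : V →ₗ[ℂ] V) (v : V) (hv : v ≠ 0) :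
    Projectivization.mk ℂ v hv ∈ locus H h ↔ H (h v) v = 0 := by
  obtain ⟨a, ha⟩ := Projectivization.exists_smul_eq_mk_rep ℂ v hv
  have h0 : (a : ℂ) ≠ 0 := a.ne_zero
  simp only [locus, Set.mem_ofPred_eq, ← ha, Units.smul_def, map_smul, map_smulₛₗ,
    LinearMap.smul_apply, smul_eq_mul, mul_eq_zero, map_eq_zero, h0, false_or]

/-- The projectivization of `ker h` (the focus, when `h` has rank `2`). -/
def focus (h : V →ₗ[ℂ] V) : Set (ℙ ℂ V) :=
  {p | h p.rep = 0}

/-- `h` gives a bisector, namely `locus H h`. -/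
structure IsBisector (H : V →ₗ[ℂ] V →ₗ⋆[ℂ] ℂ) (h : V →ₗ[ℂ] V) : Prop where
  rank_eq : Module.finrank ℂ (LinearMap.range h) = 2
  selfAdj : H.IsSelfAdjoint h
  trace_eq : LinearMap.trace ℂ V h = 0
  ne_focus : locus H h ≠ focus h

/-- The base `B_W` of a real subspace `W` of linear maps. -/
def base (H : V →ₗ[ℂ] V →ₗ⋆[ℂ] ℂ) (W : Submodule ℝ (V →ₗ[ℂ] V)) : Set (ℙ ℂ V) :=
  {p | ∀ h ∈ W, p ∈ locus H h}

/-- The set `D_W` of the degenerate elements of `W`. -/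
def degenerate (W : Submodule ℝ (V →ₗ[ℂ] V)) : Set (V →ₗ[ℂ] V) :=
  {h | h ∈ W ∧ LinearMap.det h = 0}

/-- The image `E_W` of `D_W` in the real projectivization of `W`. -/
def curve (W : Submodule ℝ (V →ₗ[ℂ] V)) : Set (ℙ ℝ W) :=
  {x | (x.rep : V →ₗ[ℂ] V) ∈ degenerate W}

/-- `W` is a family of bisectors. -/
structure IsFamily (H : V →ₗ[ℂ] V →ₗ⋆[ℂ] ℂ) (W : Submodule ℝ (V →ₗ[ℂ] V)) : Prop where
  trace_eq : ∀ h ∈ W, LinearMap.trace ℂ V h = 0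
  base_inter_ball : (base H W ∩ ball H).Nonempty
  span_eq : Submodule.span ℝ (degenerate W) = W
  selfAdj : ∀ h ∈ W, H.IsSelfAdjoint h

/-- `W` is an elliptic family of bisectors. -/
structure IsElliptic (H : V →ₗ[ℂ] V →ₗ⋆[ℂ] ℂ) (W : Submodule ℝ (V →ₗ[ℂ] V)) : Prop where
  isFamily : IsFamily H W
  degenerate_ne : degenerate W ≠ (W : Set (V →ₗ[ℂ] V))
  finrank_eq : Module.finrank ℝ W = 3

/-- The real plane cubic `E_W`, given by `det = 0`, is irreducible: in some (equivalently, any) real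
linear coordinates on the `3`-dimensional space `W`, the restriction of `det` to `W` is an
irreducible real polynomial. -/
def IsIrreducibleCubic (W : Submodule ℝ (V →ₗ[ℂ] V)) : Prop :=
  ∃ (b : Module.Basis (Fin 3) ℝ W) (F : MvPolynomial (Fin 3) ℝ),
    (∀ x : Fin 3 → ℝ, ((MvPolynomial.eval x F : ℝ) : ℂ) =
      LinearMap.det ((∑ i, x i • b i : W) : V →ₗ[ℂ] V)) ∧ Irreducible F

/-- The map `⟨-, p⟩ p`. -/
def rankOne (H : V →ₗ[ℂ] V →ₗ⋆[ℂ] ℂ) (p : V) : V →ₗ[ℂ] V :=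
  (H.flip p).smulRight p

/-- `W` is equitant from the four points of the complex projective plane with the representatives
`p i`: the points have the same signature `σ`, no three of them are on the same complex projective
line, the representatives are normalized by `⟨p i, p i⟩ = σ`, some negative `q` satisfies
`|⟨q, p i⟩| = 1` for all `i`, and `W` consists of the maps `∑ i, r i ⟨-, p i⟩ p i` with real
coefficients of sum zero. -/
structure IsEquitantFrom (H : V →ₗ[ℂ] V →ₗ⋆[ℂ] ℂ) (σ : ℝ) (p : Fin 4 → V)
    (W : Submodule ℝ (V →ₗ[ℂ] V)) : Prop where
  signature : σ = 1 ∨ σ = -1 ∨ σ = 0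
  normalized : ∀ i, H (p i) (p i) = (σ : ℂ)
  generic : ∀ i j k : Fin 4, i ≠ j → j ≠ k → i ≠ k → LinearIndependent ℂ ![p i, p j, p k]
  exists_equidistant : ∃ q : V, (H q q).re < 0 ∧ ∀ i, ‖H q (p i)‖ = 1
  coe_eq : (W : Set (V →ₗ[ℂ] V)) =
    {h | ∃ r : Fin 4 → ℝ, ∑ i, r i = 0 ∧ h = ∑ i, r i • rankOne H (p i)}

/-- `W` is equitant from some four points. -/
def IsEquitant (H : V →ₗ[ℂ] V →ₗ⋆[ℂ] ℂ) (W : Submodule ℝ (V →ₗ[ℂ] V)) : Prop :=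
  ∃ (σ : ℝ) (p : Fin 4 → V), IsEquitantFrom H σ p W

end

end CHyp

/-! Only the inclusion of the right side in `W` needs work. Any three of the `pᵢ` are independent,
so `p₃ = ∑ dₖ pₖ` with all `dₖ ≠ 0`; put `Aₖ = |dₖ|²` and `A₃ = 1`. A point `b` of the base is
equidistant from the `pᵢ`: all `|⟨b, pᵢ⟩|²` equal one `T`. Write `yₖ = d̄ₖ⟨b, pₖ⟩` for `k < 3` and
`y₃ = -(y₀ + y₁ + y₂)`. Then `ȳₖ = Aₖ T / yₖ` eliminates the conjugates and leaves the complex plane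
cubic `∑ yᵢ = 0`, `∑ Aᵢ / yᵢ = 0`. Up to the Gram determinant, `det` on `W` is the same cubic in the
coefficients `rᵢ` (`det_sum_rankOne`), so irreducibility of `E_W` excludes the pairings of equal
`Aᵢ` on which the cubic splits (`not_factor`). For selfadjoint `h`, the same substitution turns
`⟨hb, b⟩ = 0` into another cubic. Having infinitely many common points with the first one, it is
proportional to it (`proportional_of_infinite_affineCubic`). Comparing coefficients gives `h ∈ W`
(`exists_eq_sum_rankOne`). The statement on bisectors follows: nonzero degenerate elements of `W`
have rank `2` (`finrank_range_eq_two`), and an infinite `B` does not fit into a one-point focus. -/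

namespace CHyp

/-! ### Elimination for plane cubics. -/

open Polynomial in
/-- A quartic `(A₃X² + eX + A₁)² - 4kX²` with `A₁, A₃, k ≠ 0` is a square only if `e = 0` and
`k = A₁A₃`. -/
theorem eq_of_sq_eq_quartic {A₁ A₃ e k : ℂ} (h1 : A₁ ≠ 0) (h3 : A₃ ≠ 0) (hk : k ≠ 0)
    (M : ℂ[X])
    (hM : M ^ 2 = (C A₃ * X ^ 2 + C e * X + C A₁) ^ 2 - C (4 * k) * X ^ 2) :
    e = 0 ∧ k = A₁ * A₃ := by
  have hE : (C A₃ * X ^ 2 + C e * X + C A₁) ^ 2 - C (4 * k) * X ^ 2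
      = C (A₃ ^ 2) * X ^ 4 + C (2 * A₃ * e) * X ^ 3 + C (e ^ 2 + 2 * A₁ * A₃ - 4 * k) * X ^ 2
        + C (2 * A₁ * e) * X + C (A₁ ^ 2) := by
    simp only [C_mul, C_pow, C_add, C_sub, C_ofNat]
    ring
  rw [hE] at hM
  have hdeg : M.natDegree ≤ 2 := by
    have h4 : (M ^ 2).natDegree ≤ 4 := by rw [hM]; compute_degree
    rw [natDegree_pow] at h4
    omega
  obtain ⟨a, b, c, rfl⟩ : ∃ a b c : ℂ, M = C a * X ^ 2 + C b * X + C c := by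
    refine ⟨M.coeff 2, M.coeff 1, M.coeff 0, ?_⟩
    conv_lhs => rw [M.as_sum_range_C_mul_X_pow' (n := 3) (by omega)]
    simp [Finset.sum_range_succ]
    ring
  have hE' : (C a * X ^ 2 + C b * X + C c) ^ 2
      = C (a ^ 2) * X ^ 4 + C (2 * a * b) * X ^ 3 + C (b ^ 2 + 2 * c * a) * X ^ 2
        + C (2 * c * b) * X + C (c ^ 2) := by
    simp only [C_mul, C_pow, C_add, C_ofNat]
    ring
  rw [hE'] at hM
  have hcoeff (n : ℕ) := congrArg (coeff · n) hM
  simp only [coeff_add, coeff_C_mul, coeff_X_pow, coeff_X, coeff_C] at hcoeff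
  have c0 : c ^ 2 = A₁ ^ 2 := by simpa [-map_mul, -map_add, -map_sub, -map_pow] using hcoeff 0
  have c1 : 2 * c * b = 2 * A₁ * e := by
    simpa [-map_mul, -map_add, -map_sub, -map_pow] using hcoeff 1
  have c2 : b ^ 2 + 2 * c * a = e ^ 2 + 2 * A₁ * A₃ - 4 * k := by
    simpa [-map_mul, -map_add, -map_sub, -map_pow] using hcoeff 2
  have c3 : 2 * a * b = 2 * A₃ * e := by
    simpa [-map_mul, -map_add, -map_sub, -map_pow] using hcoeff 3
  have c4 : a ^ 2 = A₃ ^ 2 := by simpa [-map_mul, -map_add, -map_sub, -map_pow] using hcoeff 4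
  -- If `a/A₃` and `c/A₁` are the same sign, the `X²` coefficients force `k = 0`. Opposite signs
  -- give both `b = e` and `b = -e`.
  have same : b ≠ e ∨ c * a ≠ A₁ * A₃ := by
    by_contra! hc
    apply hk
    rw [hc.1] at c2
    linear_combination (1 / 4 : ℂ) * c2 - (1 / 2 : ℂ) * hc.2
  have same' : b ≠ -e ∨ c * a ≠ A₁ * A₃ := by
    by_contra! hc
    apply hk
    rw [hc.1] at c2
    linear_combination (1 / 4 : ℂ) * c2 - (1 / 2 : ℂ) * hc.2
  rcases sq_eq_sq_iff_eq_or_eq_neg.mp c0 with rfl | rfl <;>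
    rcases sq_eq_sq_iff_eq_or_eq_neg.mp c4 with rfl | rfl
  · have : b = e := mul_left_cancel₀ h1 (by linear_combination c1 / 2)
    simp_all
  · have hb : b = e := mul_left_cancel₀ h1 (by linear_combination c1 / 2)
    have hb' : b = -e := mul_left_cancel₀ h3 (by linear_combination -c3 / 2)
    have he : e = 0 := by linear_combination (hb' - hb) / 2
    exact ⟨he, by rw [hb] at c2; linear_combination (1 / 4 : ℂ) * c2⟩
  · have hb : b = -e := mul_left_cancel₀ h1 (by linear_combination -c1 / 2)
    have hb' : b = e := mul_left_cancel₀ h3 (by linear_combination c3 / 2)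
    have he : e = 0 := by linear_combination (hb - hb') / 2
    exact ⟨he, by rw [hb'] at c2; linear_combination (1 / 4 : ℂ) * c2⟩
  · have : b = -e := mul_left_cancel₀ h1 (by linear_combination -c1 / 2)
    exact absurd (by ring) (same'.resolve_left (by simpa using this))

open Polynomial in
/-- Two quadratics over `ℂ[X]` whose resultant vanishes: either the discriminant of the first is a
square or they are proportional. -/
theorem exists_sq_or_of_resultant_eq_zero {a b c a' b' c' : ℂ[X]}
    (hR : (a * c' - a' * c) ^ 2 = (a * b' - a' * b) * (b * c' - b' * c)) :
    (∃ M, M ^ 2 = b ^ 2 - 4 * a * c) ∨ (a * b' = a' * b ∧ a * c' = a' * c) := by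
  by_cases hQ : a * b' - a' * b = 0
  · right
    rw [hQ, zero_mul] at hR
    exact ⟨sub_eq_zero.mp hQ, sub_eq_zero.mp (pow_eq_zero_iff two_ne_zero |>.mp hR)⟩
  · left
    -- The common root is `y = -(a c' - a' c) / (a b' - a' b)`, and the discriminant of the first
    -- quadratic is `(2 a y + b)²`. The root is rational, hence so is this square root, and integral
    -- closedness makes it a polynomial.
    have key : (2 * a * (a * c' - a' * c) - b * (a * b' - a' * b)) ^ 2
        = (a * b' - a' * b) ^ 2 * (b ^ 2 - 4 * a * c) := by
      linear_combination (4 * a ^ 2) * hR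
    obtain ⟨M, hM⟩ : (a * b' - a' * b) ∣ (2 * a * (a * c' - a' * c) - b * (a * b' - a' * b)) :=
      (IsIntegrallyClosed.pow_dvd_pow_iff two_ne_zero).mp (Dvd.intro _ key.symm)
    refine ⟨M, ?_⟩
    rw [hM, mul_pow] at key
    exact mul_left_cancel₀ (pow_ne_zero 2 hQ) key

/-- The affine equation of the plane cubic `∑ yᵢ = 0`, `∑ Aᵢ / yᵢ = 0`. -/
def affineCubic (A₁ A₂ A₃ A₄ x y : ℂ) : ℂ :=
  (A₄ - A₁ - A₂ - A₃) * (x * y) - A₁ * (y * (y + 1)) - A₂ * (x * (x + 1)) - A₃ * (x * y * (x + y))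

/-- The only vertical line that the cubic can contain is `x = -1`, and `hp` excludes it. -/
theorem finite_affineCubic_fiber {A₁ A₂ A₃ A₄ : ℂ} (h1 : A₁ ≠ 0) (h2 : A₂ ≠ 0)
    (hp : ¬(A₁ = A₃ ∧ A₂ = A₄)) (x : ℂ) : {y | affineCubic A₁ A₂ A₃ A₄ x y = 0}.Finite := by
  open Polynomial in
  let f : ℂ[X] := C (-(A₁ + A₃ * x)) * X ^ 2 + C ((A₄ - A₁ - A₂ - A₃) * x - A₁ - A₃ * x ^ 2) * X
    + C (-(A₂ * x * (x + 1)))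
  have hf : f ≠ 0 := by
    intro hf
    have c0 : A₂ * x * (x + 1) = 0 := by
      simpa [f, Polynomial.coeff_X, Polynomial.coeff_C] using congrArg (Polynomial.coeff · 0) hf
    have c1 : (A₄ - A₁ - A₂ - A₃) * x - A₁ - A₃ * x ^ 2 = 0 := by
      have := congrArg (Polynomial.coeff · 1) hf
      simp only [f, Polynomial.coeff_add, Polynomial.coeff_C_mul, Polynomial.coeff_X_pow,
        Polynomial.coeff_C, Polynomial.coeff_X, Polynomial.coeff_zero] at this
      simpa using this
    have c2 : -(A₁ + A₃ * x) = 0 := by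
      have := congrArg (Polynomial.coeff · 2) hf
      simp only [f, Polynomial.coeff_add, Polynomial.coeff_C_mul, Polynomial.coeff_X_pow,
        Polynomial.coeff_C, Polynomial.coeff_X, Polynomial.coeff_zero] at this
      simpa using this
    rcases mul_eq_zero.mp c0 with h | h
    · rcases mul_eq_zero.mp h with h | rfl
      · exact h2 h
      · exact h1 (by linear_combination -c2)
    · obtain rfl : x = -1 := by linear_combination h
      exact hp ⟨by linear_combination -c2, by linear_combination c1⟩
  refine (Polynomial.finite_setOfPred_isRoot hf).subset fun y hy => ?_
  simp only [affineCubic, Set.mem_ofPred_eq] at hy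
  simp only [Set.mem_ofPred_eq, Polynomial.IsRoot, f, Polynomial.eval_add, Polynomial.eval_mul,
    Polynomial.eval_C, Polynomial.eval_pow, Polynomial.eval_X]
  linear_combination hy

-- A cubic without the `y²` term cannot be a nonzero multiple of `affineCubic`, as `A₁ ≠ 0`. Both
-- equations are treated as quadratics in `y` over `ℂ[x]`; their resultant vanishes at infinitely
-- many `x`.
open Polynomial in
theorem eq_zero_of_infinite_affineCubic {A₁ A₂ A₃ A₄ : ℂ} (h1 : A₁ ≠ 0) (h2 : A₂ ≠ 0)
    (h3 : A₃ ≠ 0) (h4 : A₄ ≠ 0) (hp : ¬(A₁ = A₃ ∧ A₂ = A₄)) (hp' : ¬(A₁ = A₂ ∧ A₃ = A₄))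
    (hp'' : ¬(A₁ = A₄ ∧ A₂ = A₃)) {S : Set (ℂ × ℂ)} (hS : S.Infinite)
    (hf : ∀ z ∈ S, affineCubic A₁ A₂ A₃ A₄ z.1 z.2 = 0) {g₀ g₂ g₃ g₄ g₅ g₆ : ℂ}
    (hg : ∀ z ∈ S, g₀ * (z.1 * z.2) + g₂ * z.2 + g₃ * z.1 ^ 2 + g₄ * z.1
      + g₅ * (z.1 ^ 2 * z.2) + g₆ * (z.1 * z.2 ^ 2) = 0) :
    g₀ = 0 ∧ g₂ = 0 ∧ g₃ = 0 ∧ g₄ = 0 ∧ g₅ = 0 ∧ g₆ = 0 := by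
  have hT : (Prod.fst '' S).Infinite := by
    intro hfin
    refine hS ((hfin.biUnion (t := fun x =>
      Prod.mk x '' {y | affineCubic A₁ A₂ A₃ A₄ x y = 0})
      fun x _ => (finite_affineCubic_fiber h1 h2 hp x).image _).subset fun z hz => ?_)
    simp only [Set.mem_iUnion]
    exact ⟨z.1, ⟨z, hz, rfl⟩, z.2, hf z hz, rfl⟩
  let a : ℂ[X] := C (-A₁) + C (-A₃) * X
  let b : ℂ[X] := C (-A₃) * X ^ 2 + C (A₄ - A₁ - A₂ - A₃) * X + C (-A₁)
  let c : ℂ[X] := C (-A₂) * X ^ 2 + C (-A₂) * X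
  let a' : ℂ[X] := C g₆ * X
  let b' : ℂ[X] := C g₅ * X ^ 2 + C g₀ * X + C g₂
  let c' : ℂ[X] := C g₃ * X ^ 2 + C g₄ * X
  have hR : (a * c' - a' * c) ^ 2 = (a * b' - a' * b) * (b * c' - b' * c) := by
    refine Polynomial.eq_of_infinite_eval_eq _ _ (hT.mono ?_)
    rintro _ ⟨⟨x, y⟩, hz, rfl⟩
    have e1 : a.eval x * y ^ 2 + b.eval x * y + c.eval x = 0 := by
      have := hf _ hz
      simp only [affineCubic] at this
      simp only [a, b, c, eval_add, eval_mul, eval_C, eval_pow, eval_X]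
      linear_combination this
    have e2 : a'.eval x * y ^ 2 + b'.eval x * y + c'.eval x = 0 := by
      have := hg _ hz
      simp only at this
      simp only [a', b', c', eval_add, eval_mul, eval_C, eval_pow, eval_X]
      linear_combination this
    simp only [Set.mem_ofPred_eq, eval_sub, eval_mul, eval_pow]
    generalize a.eval x = a, b.eval x = b, c.eval x = c, a'.eval x = a', b'.eval x = b',
      c'.eval x = c' at e1 e2
    obtain rfl : c = -(a * y ^ 2 + b * y) := by linear_combination e1
    obtain rfl : c' = -(a' * y ^ 2 + b' * y) := by linear_combination e2
    ring
  have ha : a ≠ 0 := fun h => h1 (by simpa [a] using congrArg (eval 0) h)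
  rcases exists_sq_or_of_resultant_eq_zero hR with ⟨M, hM⟩ | ⟨hb, hc⟩
  · exfalso
    -- A square discriminant yields `A₁ + A₃ = A₂ + A₄` and `A₁A₃ = A₂A₄`, that is, one of the two
    -- pairings excluded by `hp'` and `hp''`.
    have hD : b ^ 2 - 4 * a * c = (C A₃ * X ^ 2 + C (A₁ + A₃ - A₂ - A₄) * X + C A₁) ^ 2
        - C (4 * (A₂ * A₄)) * X ^ 2 := by
      simp only [a, b, c, C_mul, C_neg, C_add, C_sub, C_ofNat]
      ring
    obtain ⟨e, k⟩ := eq_of_sq_eq_quartic h1 h3 (mul_ne_zero h2 h4) M (hM.trans hD)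
    have : (A₁ - A₂) * (A₁ - A₄) = 0 := by linear_combination A₁ * e + k
    rcases mul_eq_zero.mp this with h | h
    · exact hp' ⟨by linear_combination h, by linear_combination e - h⟩
    · exact hp'' ⟨by linear_combination h, by linear_combination h - e⟩
  · have h6 : g₆ = 0 := by
      by_contra h6
      -- At the root of `a`, proportionality would make `b` and `c` vanish too, giving the forbidden
      -- line `x = -1`.
      obtain ⟨x, hx⟩ : ∃ x, A₁ + A₃ * x = 0 := ⟨-A₁ / A₃, by field_simp; ring⟩
      have hx0 : x ≠ 0 := by
        rintro rfl
        exact h1 (by linear_combination hx)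
      have hb := congrArg (eval x) hb
      have hc := congrArg (eval x) hc
      simp only [a, b, c, a', b', c', eval_add, eval_mul, eval_C, eval_pow, eval_X] at hb hc
      have e1 : g₆ * x * x * A₂ * (x + 1) = 0 := by
        linear_combination hc + (g₃ * x ^ 2 + g₄ * x) * hx
      have e2 : g₆ * x * (-A₃ * x ^ 2 + (A₄ - A₁ - A₂ - A₃) * x + -A₁) = 0 := by
        linear_combination -hb - (g₅ * x ^ 2 + g₀ * x + g₂) * hx
      obtain rfl : x = -1 := by
        simpa [h6, hx0, h2, add_eq_zero_iff_eq_neg] using e1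
      have e3 := (mul_eq_zero.mp e2).resolve_left (mul_ne_zero h6 hx0)
      exact hp ⟨by linear_combination hx, by linear_combination e3⟩
    have ha' : a' = 0 := by simp [a', h6]
    rw [ha', zero_mul, mul_eq_zero, or_iff_right ha] at hb hc
    refine ⟨?_, ?_, ?_, ?_, ?_, h6⟩
    · simpa [b', coeff_X, coeff_C] using congrArg (coeff · 1) hb
    · simpa [b', coeff_X, coeff_C] using congrArg (coeff · 0) hb
    · simpa [c', coeff_X, coeff_C] using congrArg (coeff · 2) hc
    · simpa [c', coeff_X, coeff_C] using congrArg (coeff · 1) hc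
    · simpa [b', coeff_X, coeff_C] using congrArg (coeff · 2) hb

theorem proportional_of_infinite_affineCubic {A₁ A₂ A₃ A₄ : ℂ} (h1 : A₁ ≠ 0) (h2 : A₂ ≠ 0)
    (h3 : A₃ ≠ 0) (h4 : A₄ ≠ 0) (hp : ¬(A₁ = A₃ ∧ A₂ = A₄)) (hp' : ¬(A₁ = A₂ ∧ A₃ = A₄))
    (hp'' : ¬(A₁ = A₄ ∧ A₂ = A₃)) {S : Set (ℂ × ℂ)} (hS : S.Infinite)
    (hf : ∀ z ∈ S, affineCubic A₁ A₂ A₃ A₄ z.1 z.2 = 0) {g₀ g₁ g₂ g₃ g₄ g₅ g₆ : ℂ}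
    (hg : ∀ z ∈ S, g₀ * (z.1 * z.2) + g₁ * z.2 ^ 2 + g₂ * z.2 + g₃ * z.1 ^ 2 + g₄ * z.1
      + g₅ * (z.1 ^ 2 * z.2) + g₆ * (z.1 * z.2 ^ 2) = 0) :
    ∃ l : ℂ, g₀ = -l * (A₄ - A₁ - A₂ - A₃) ∧ g₁ = l * A₁ ∧ g₂ = l * A₁ ∧ g₃ = l * A₂ ∧
      g₄ = l * A₂ ∧ g₅ = l * A₃ ∧ g₆ = l * A₃ := by
  -- The multiple of `affineCubic` with factor `-g₁ / A₁` has the same `y²` term as `g`; subtracting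
  -- it reduces to the previous lemma.
  have hl : g₁ / A₁ * A₁ = g₁ := div_mul_cancel₀ _ h1
  obtain ⟨e0, e2, e3, e4, e5, e6⟩ := eq_zero_of_infinite_affineCubic h1 h2 h3 h4 hp hp' hp'' hS hf
    (g₀ := g₀ + g₁ / A₁ * (A₄ - A₁ - A₂ - A₃)) (g₂ := g₂ - g₁ / A₁ * A₁)
    (g₃ := g₃ - g₁ / A₁ * A₂) (g₄ := g₄ - g₁ / A₁ * A₂) (g₅ := g₅ - g₁ / A₁ * A₃)
    (g₆ := g₆ - g₁ / A₁ * A₃) (fun z hz => by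
      have := hf z hz
      simp only [affineCubic] at this
      linear_combination hg z hz + g₁ / A₁ * this + z.2 ^ 2 * hl)
  refine ⟨g₁ / A₁, ?_, ?_, ?_, ?_, ?_, ?_, ?_⟩
  · linear_combination e0
  · exact hl.symm
  · linear_combination e2
  · linear_combination e3
  · linear_combination e4
  · linear_combination e5
  · linear_combination e6

/-! ### Hermitian forms of signature `++-`. -/

section Form

variable {V : Type*} [AddCommGroup V] [Module ℂ V] {H : V →ₗ[ℂ] V →ₗ⋆[ℂ] ℂ}

theorem apply_eq_sum {ι : Type*} [Fintype ι] (H : V →ₗ[ℂ] V →ₗ⋆[ℂ] ℂ) (e : Module.Basis ι ℂ V)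
    (x y : V) :
    H x y = ∑ i, ∑ j, e.repr x i * (conj (e.repr y j) * H (e i) (e j)) := by
  conv_lhs => rw [← e.sum_repr x, ← e.sum_repr y]
  simp only [map_sum, map_smul, map_smulₛₗ, LinearMap.sum_apply, LinearMap.smul_apply, smul_eq_mul,
    Finset.mul_sum]
  rw [Finset.sum_comm]
  exact Finset.sum_congr rfl fun i _ => Finset.sum_congr rfl fun j _ => by ring

theorem HasSignature21.exists_coordinates (hH : HasSignature21 H) :
    ∃ e : Module.Basis (Fin 3) ℂ V, ∀ x y, H x y = e.repr x 0 * conj (e.repr y 0)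
      + e.repr x 1 * conj (e.repr y 1) - e.repr x 2 * conj (e.repr y 2) := by
  obtain ⟨e, he⟩ := hH
  refine ⟨e, fun x y => ?_⟩
  rw [apply_eq_sum H e]
  simp [Fin.sum_univ_three, he, sub_eq_add_neg]

theorem HasSignature21.conj_apply (hH : HasSignature21 H) (x y : V) : conj (H x y) = H y x := by
  obtain ⟨e, he⟩ := hH.exists_coordinates
  simp only [he, map_add, map_sub, map_mul, Complex.conj_conj]
  ring

theorem HasSignature21.eq_zero_of_forall (hH : HasSignature21 H) {x : V} (hx : ∀ y, H x y = 0) :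
    x = 0 := by
  obtain ⟨e, he⟩ := hH.exists_coordinates
  refine e.repr.injective (Finsupp.ext fun i => ?_)
  have := hx (e i)
  rw [he] at this
  fin_cases i <;> simpa using this

/-- The orthogonal complement of a negative vector is positive definite; in coordinates this is
Lagrange's identity `hlag`. -/
theorem HasSignature21.eq_zero_of_isotropic (hH : HasSignature21 H) {n w : V}
    (hn : (H n n).re < 0) (hw : H w w = 0) (hnw : H w n = 0) : w = 0 := by
  obtain ⟨e, he⟩ := hH.exists_coordinates
  rw [he] at hn hw hnw
  generalize e.repr n 0 = a, e.repr n 1 = b, e.repr n 2 = c at hn hnw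
  have h0 : e.repr w = 0 → w = 0 := fun h => by simpa using h
  refine h0 (Finsupp.ext ?_)
  suffices e.repr w 0 = 0 ∧ e.repr w 1 = 0 ∧ e.repr w 2 = 0 by
    intro i
    fin_cases i <;> simp [this]
  generalize e.repr w 0 = x, e.repr w 1 = y, e.repr w 2 = z at hw hnw
  simp only [Complex.mul_conj, Complex.sub_re, Complex.add_re, Complex.ofReal_re] at hn
  simp only [Complex.mul_conj] at hw
  norm_cast at hw
  have hz : x * conj a + y * conj b = z * conj c := by linear_combination hnw
  have hlag : Complex.normSq (x * conj a + y * conj b) + Complex.normSq (x * b - y * a)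
      = (Complex.normSq x + Complex.normSq y) * (Complex.normSq a + Complex.normSq b) := by
    simp only [Complex.normSq_apply, Complex.add_re, Complex.add_im, Complex.sub_re,
      Complex.sub_im, Complex.mul_re, Complex.mul_im, Complex.conj_re, Complex.conj_im]
    ring
  rw [hz, map_mul, Complex.normSq_conj] at hlag
  have hxy : Complex.normSq x + Complex.normSq y = Complex.normSq z := by linarith
  rw [hxy] at hlag
  have hz0 : Complex.normSq z = 0 := by
    by_contra hne
    have hpos : 0 < Complex.normSq z := lt_of_le_of_ne (Complex.normSq_nonneg _) (Ne.symm hne)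
    have := Complex.normSq_nonneg (x * b - y * a)
    nlinarith [mul_pos hpos (sub_pos.mpr hn)]
  have hx := Complex.normSq_nonneg x
  have hy := Complex.normSq_nonneg y
  exact ⟨Complex.normSq_eq_zero.mp (by linarith), Complex.normSq_eq_zero.mp (by linarith),
    Complex.normSq_eq_zero.mp hz0⟩

theorem HasSignature21.finrank_eq (hH : HasSignature21 H) : Module.finrank ℂ V = 3 := by
  obtain ⟨e, -⟩ := hH
  simpa using Module.finrank_eq_card_basis e

theorem rankOne_apply (H : V →ₗ[ℂ] V →ₗ⋆[ℂ] ℂ) (p x : V) : rankOne H p x = H x p • p := rfl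

/-- The basis dual to `p` with respect to the form. -/
theorem HasSignature21.exists_dual_basis (hH : HasSignature21 H) (p : Module.Basis (Fin 3) ℂ V) :
    ∃ v : Module.Basis (Fin 3) ℂ V, ∀ b i, v.repr b i = H b (p i) := by
  have : FiniteDimensional ℂ V := p.finiteDimensional_of_finite
  let L : V →ₗ[ℂ] Fin 3 → ℂ := LinearMap.pi fun i => H.flip (p i)
  have hL : Function.Injective L := by
    rw [← LinearMap.ker_eq_bot, LinearMap.ker_eq_bot']
    intro x hx
    refine hH.eq_zero_of_forall fun y => ?_
    rw [← p.sum_repr y, map_sum]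
    refine Finset.sum_eq_zero fun i _ => ?_
    have : H x (p i) = 0 := congrFun hx i
    rw [map_smulₛₗ, this, smul_zero]
  exact ⟨.ofEquivFun (LinearEquiv.ofInjectiveOfFinrankEq L hL (by simp [hH.finrank_eq])),
    fun b i => rfl⟩

/-! ### The determinant on an equitant family. -/

/-- The determinant of `∑ rₖ ⟨-, pₖ⟩ pₖ + s ⟨-, p₃⟩ p₃` for a basis `p₀, p₁, p₂` and
`p₃ = ∑ dₖ pₖ`. -/
theorem det_sum_rankOne (H : V →ₗ[ℂ] V →ₗ⋆[ℂ] ℂ) (p : Module.Basis (Fin 3) ℂ V) (d r : Fin 3 → ℂ)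
    (s : ℂ) :
    LinearMap.det (∑ k, r k • rankOne H (p k) + s • rankOne H (∑ k, d k • p k)) =
      (Matrix.of fun l j => H (p j) (p l)).det * (r 0 * r 1 * r 2
        + s * (d 0 * conj (d 0) * (r 1 * r 2) + d 1 * conj (d 1) * (r 0 * r 2)
          + d 2 * conj (d 2) * (r 0 * r 1))) := by
  -- A diagonal matrix plus a rank one matrix, times the Gram matrix.
  have hM : LinearMap.toMatrix p p (∑ k, r k • rankOne H (p k) + s • rankOne H (∑ k, d k • p k))
      = (Matrix.diagonal r + s • Matrix.of fun k l => d k * conj (d l))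
        * (Matrix.of fun l j => H (p j) (p l)) := by
    ext k j
    rw [LinearMap.toMatrix_apply, Matrix.mul_apply]
    simp only [LinearMap.add_apply, LinearMap.smul_apply, rankOne_apply,
      map_add, map_smul, map_smulₛₗ, Finsupp.coe_add,
      Finsupp.coe_smul, Pi.add_apply, Pi.smul_apply, Module.Basis.repr_self,
      Finsupp.single_apply, Fin.sum_univ_three, Matrix.add_apply, Matrix.smul_apply,
      Matrix.of_apply, Matrix.diagonal_apply, smul_eq_mul]
    fin_cases k <;> simp <;> ring
  rw [← LinearMap.det_toMatrix p, hM, Matrix.det_mul, mul_comm]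
  congr 1
  simp [Matrix.det_fin_three]
  ring

theorem not_irreducible_of_eval_eq {ι : Type*} [Fintype ι] {F l q : MvPolynomial ι ℝ} {c : ℂ}
    (hl : MvPolynomial.constantCoeff l = 0) (hq : MvPolynomial.constantCoeff q = 0)
    (h : ∀ x, ((MvPolynomial.eval x F : ℝ) : ℂ)
      = c * ((MvPolynomial.eval x l * MvPolynomial.eval x q : ℝ) : ℂ)) : ¬Irreducible F := by
  intro hF
  have hFe : F = l * (MvPolynomial.C c.re * q) := by
    refine MvPolynomial.funext fun x => ?_
    have := congrArg Complex.re (h x)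
    rw [Complex.ofReal_re, Complex.re_mul_ofReal] at this
    rw [this]
    simp only [map_mul, MvPolynomial.eval_C]
    ring
  rcases hF.isUnit_or_isUnit hFe with hu | hu
  · simpa [hl] using hu.map MvPolynomial.constantCoeff
  · simpa [hq] using hu.map MvPolynomial.constantCoeff

/-- If `det` on `W` is irreducible, the cubic form `∑ Aᵢ ∏_{j ≠ i} rⱼ` (with `A₃ = 1`) does not split
off a factor `rᵢ + rⱼ` on the plane `∑ rᵢ = 0`. -/
theorem IsIrreducibleCubic.not_factor {W : Submodule ℝ (V →ₗ[ℂ] V)} (hirr : IsIrreducibleCubic W)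
    {p : Fin 4 → V}
    (hW : (W : Set (V →ₗ[ℂ] V)) =
      {h | ∃ r : Fin 4 → ℝ, ∑ i, r i = 0 ∧ h = ∑ i, r i • rankOne H (p i)})
    (P : Module.Basis (Fin 3) ℂ V) (hP : ∀ k : Fin 3, P k = p k.castSucc) {d : Fin 3 → ℂ}
    (hd : p 3 = ∑ k, d k • P k) (i j k l : Fin 4) (a b : ℝ) :
    ¬∀ r : Fin 4 → ℝ, ∑ i, r i = 0 →
      r 0 * r 1 * r 2 + r 3 * (Complex.normSq (d 0) * (r 1 * r 2)
        + Complex.normSq (d 1) * (r 0 * r 2) + Complex.normSq (d 2) * (r 0 * r 1))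
      = (r i + r j) * (a * (r k * r l) - b * (r i * r j)) := by
  intro hfac
  obtain ⟨β, F, hF, hFirr⟩ := hirr
  have hβ (m : Fin 3) : ∃ r : Fin 4 → ℝ, ∑ i, r i = 0 ∧
      (β m : V →ₗ[ℂ] V) = ∑ i, r i • rankOne H (p i) := by
    have : (β m : V →ₗ[ℂ] V) ∈ (W : Set (V →ₗ[ℂ] V)) := (β m).2
    rwa [hW] at this
  choose R hR0 hR using hβ
  let ρ (i : Fin 4) : MvPolynomial (Fin 3) ℝ := ∑ m, MvPolynomial.C (R m i) * MvPolynomial.X m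
  have hρ (x : Fin 3 → ℝ) (i : Fin 4) : MvPolynomial.eval x (ρ i) = ∑ m, R m i * x m := by
    simp [ρ]
  have hρ0 (i : Fin 4) : MvPolynomial.constantCoeff (ρ i) = 0 := by simp [ρ]
  refine not_irreducible_of_eval_eq (F := F) (l := ρ i + ρ j)
    (q := MvPolynomial.C a * (ρ k * ρ l) - MvPolynomial.C b * (ρ i * ρ j))
    (c := (Matrix.of fun l j => H (P j) (P l)).det) (by simp [hρ0]) (by simp [hρ0])
    (fun x => ?_) hFirr
  let r (i : Fin 4) : ℝ := ∑ m, R m i * x m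
  have hr : ∑ i, r i = 0 := by
    simp only [r]
    rw [Finset.sum_comm]
    simp [← Finset.sum_mul, hR0]
  have hsum : ((∑ m, x m • β m : W) : V →ₗ[ℂ] V)
      = ∑ m : Fin 3, ((r m.castSucc : ℝ) : ℂ) • rankOne H (P m)
        + ((r 3 : ℝ) : ℂ) • rankOne H (∑ k, d k • P k) := by
    have : ((∑ m, x m • β m : W) : V →ₗ[ℂ] V) = ∑ i, r i • rankOne H (p i) := by
      simp only [Submodule.coe_sum, Submodule.coe_smul, hR, Finset.smul_sum, smul_smul, r,
        Finset.sum_smul]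
      rw [Finset.sum_comm]
      simp only [mul_comm]
    rw [this, Fin.sum_univ_castSucc]
    rw [← hd]
    simp only [Complex.coe_smul, hP, Fin.reduceLast]
  rw [hF, hsum, det_sum_rankOne]
  congr 1
  simp only [Complex.mul_conj, map_add, map_sub, map_mul, MvPolynomial.eval_C, hρ]
  have := hfac r hr
  simp only [Fin.castSucc_zero, Fin.castSucc_one, show (Fin.castSucc 2 : Fin 4) = 2 from rfl]
  exact_mod_cast this

/-! ### From equidistant points to cubics. -/

/-- A point with `|x₀ + x₁ + x₂|² = |xₖ|² = T` after the rescaling `yₖ = d̄ₖ xₖ` lies on the affine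
cubic. -/
theorem affineCubic_eq_zero {A₁ A₂ A₃ T u v w u' v' w' : ℂ} (hT : T ≠ 0) (hw : w ≠ 0)
    (hu' : u * u' = A₁ * T) (hv' : v * v' = A₂ * T) (hw' : w * w' = A₃ * T)
    (hs : (u + v + w) * (u' + v' + w') = T) :
    affineCubic A₁ A₂ A₃ 1 (u / w) (v / w) = 0 := by
  have key : T * ((1 - A₁ - A₂ - A₃) * (u * v * w) - A₁ * (v * w * (v + w))
      - A₂ * (u * w * (u + w)) - A₃ * (u * v * (u + v))) = 0 := by
    linear_combination (-(u * v * w)) * hs + (u + v + w) * (v * w * hu' + u * w * hv' + u * v * hw')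
  have key := (mul_eq_zero.mp key).resolve_left hT
  rw [affineCubic]
  field_simp
  linear_combination key

/-- Multiplying the sesquilinear equation by `u v w` and eliminating the primed variables leaves the
seven monomials of `affineCubic`: the off-diagonal `n i j` sit at the six vertices of a hexagon, the
diagonal ones merge at its centre. -/
theorem hexagon_eq_zero {A₁ A₂ A₃ T u v w u' v' w' : ℂ} (hT : T ≠ 0) (hw : w ≠ 0)
    (hu' : u * u' = A₁ * T) (hv' : v * v' = A₂ * T) (hw' : w * w' = A₃ * T)
    {n : Fin 3 → Fin 3 → ℂ}
    (hn : n 0 0 * (u * u') + n 0 1 * (u * v') + n 0 2 * (u * w') + n 1 0 * (v * u')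
      + n 1 1 * (v * v') + n 1 2 * (v * w') + n 2 0 * (w * u') + n 2 1 * (w * v')
      + n 2 2 * (w * w') = 0) :
    (n 0 0 * A₁ + n 1 1 * A₂ + n 2 2 * A₃) * (u / w * (v / w)) + n 1 0 * A₁ * (v / w) ^ 2
      + n 2 0 * A₁ * (v / w) + n 0 1 * A₂ * (u / w) ^ 2 + n 2 1 * A₂ * (u / w)
      + n 0 2 * A₃ * ((u / w) ^ 2 * (v / w)) + n 1 2 * A₃ * (u / w * (v / w) ^ 2) = 0 := by
  have key : T * ((n 0 0 * A₁ + n 1 1 * A₂ + n 2 2 * A₃) * (u * v * w) + n 1 0 * A₁ * (v ^ 2 * w)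
      + n 2 0 * A₁ * (v * w ^ 2) + n 0 1 * A₂ * (u ^ 2 * w) + n 2 1 * A₂ * (u * w ^ 2)
      + n 0 2 * A₃ * (u ^ 2 * v) + n 1 2 * A₃ * (u * v ^ 2)) = 0 := by
    linear_combination (u * v * w) * hn
      - (n 0 0 * (u * v * w) + n 1 0 * (v ^ 2 * w) + n 2 0 * (v * w ^ 2)) * hu'
      - (n 1 1 * (u * v * w) + n 0 1 * (u ^ 2 * w) + n 2 1 * (u * w ^ 2)) * hv'
      - (n 2 2 * (u * v * w) + n 0 2 * (u ^ 2 * v) + n 1 2 * (u * v ^ 2)) * hw'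
  have key := (mul_eq_zero.mp key).resolve_left hT
  field_simp
  linear_combination key

theorem HasSignature21.ext_basis (hH : HasSignature21 H) {h h' : V →ₗ[ℂ] V}
    (v : Module.Basis (Fin 3) ℂ V) (hv : ∀ i j, H (h (v i)) (v j) = H (h' (v i)) (v j)) :
    h = h' := by
  refine v.ext fun i => sub_eq_zero.mp (hH.eq_zero_of_forall fun y => ?_)
  rw [← v.sum_repr y, map_sum]
  refine Finset.sum_eq_zero fun j _ => ?_
  rw [map_smulₛₗ, map_sub, LinearMap.sub_apply, hv, sub_self, smul_zero]

/-- Selfadjoint maps vanishing on an infinite set of points equidistant from `p₀, …, p₃` are real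
combinations of the `⟨-, pᵢ⟩ pᵢ`. -/
theorem HasSignature21.exists_eq_sum_rankOne (hH : HasSignature21 H)
    (P : Module.Basis (Fin 3) ℂ V) {d : Fin 3 → ℂ} (hd : ∀ k, d k ≠ 0)
    (hp : ¬(Complex.normSq (d 0) = Complex.normSq (d 2) ∧ Complex.normSq (d 1) = 1))
    (hp' : ¬(Complex.normSq (d 0) = Complex.normSq (d 1) ∧ Complex.normSq (d 2) = 1))
    (hp'' : ¬(Complex.normSq (d 0) = 1 ∧ Complex.normSq (d 1) = Complex.normSq (d 2)))
    {B : Set (ℙ ℂ V)} (hB : B.Infinite)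
    (heq : ∀ b ∈ B, ∀ k, Complex.normSq (H b.rep (P k))
      = Complex.normSq (H b.rep (∑ k, d k • P k)))
    {h : V →ₗ[ℂ] V} (hh : H.IsSelfAdjoint h) (hhB : ∀ b ∈ B, H (h b.rep) b.rep = 0) :
    ∃ (r : Fin 3 → ℝ) (s : ℝ), ∑ k, r k + s = 0 ∧
      h = ∑ k, r k • rankOne H (P k) + s • rankOne H (∑ k, d k • P k) := by
  obtain ⟨v, hv⟩ := hH.exists_dual_basis P
  have hc (k) : conj (d k) ≠ 0 := by simpa using hd k
  have hA (k) : (Complex.normSq (d k) : ℂ) ≠ 0 := by simpa using hd k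
  have hvP (i k) : H (v i) (P k) = if i = k then 1 else 0 := by
    rw [← hv, v.repr_self, Finsupp.single_apply]
  have hPv (i k) : H (P k) (v i) = if i = k then 1 else 0 := by
    rw [← hH.conj_apply, hvP]
    split <;> simp
  have hconj (i j) : conj (H (h (v i)) (v j)) = H (h (v j)) (v i) := by
    rw [hH.conj_apply, hh]
  let Y (b : V) (k : Fin 3) : ℂ := conj (d k) * H b (P k)
  have hsum (b : V) : H b (∑ k, d k • P k) = Y b 0 + Y b 1 + Y b 2 := by
    simp [Fin.sum_univ_three, Y]
  have hT {b : ℙ ℂ V} (hb : b ∈ B) : (Complex.normSq (H b.rep (∑ k, d k • P k)) : ℂ) ≠ 0 := by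
    intro h0
    rw [Complex.ofReal_eq_zero] at h0
    refine b.rep_nonzero (v.repr.injective (Finsupp.ext fun k => ?_))
    rw [hv, map_zero, Finsupp.zero_apply, ← Complex.normSq_eq_zero, heq b hb, h0]
  have hY {b : ℙ ℂ V} (hb : b ∈ B) (k : Fin 3) : Y b.rep k * conj (Y b.rep k)
      = (Complex.normSq (d k) : ℂ) * Complex.normSq (H b.rep (∑ k, d k • P k)) := by
    rw [Complex.mul_conj, ← heq b hb k, map_mul, Complex.normSq_conj, Complex.ofReal_mul]
  have hY0 {b : ℙ ℂ V} (hb : b ∈ B) (k : Fin 3) : Y b.rep k ≠ 0 := by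
    intro h0
    have := hY hb k
    rw [h0, zero_mul] at this
    exact mul_ne_zero (hA k) (hT hb) this.symm
  -- Normalized so that `⟨hb, b⟩ = ∑ n i j * Y b i * conj (Y b j)`.
  let n (i j : Fin 3) : ℂ := H (h (v i)) (v j) / (conj (d i) * d j)
  have hn (i j) : H (h (v i)) (v j) = n i j * (conj (d i) * d j) :=
    (div_mul_cancel₀ _ (mul_ne_zero (hc i) (hd j))).symm
  let φ (b : ℙ ℂ V) : ℂ × ℂ := (Y b.rep 0 / Y b.rep 2, Y b.rep 1 / Y b.rep 2)
  have hφ : Set.InjOn φ B := by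
    intro a ha b hb hab
    obtain ⟨h1, h2⟩ := Prod.ext_iff.mp hab
    simp only [φ] at h1 h2
    have ha2 := hY0 ha 2
    have hb2 := hY0 hb 2
    rw [div_eq_div_iff ha2 hb2] at h1 h2
    have hk (k : Fin 3) : Y a.rep k * Y b.rep 2 = Y b.rep k * Y a.rep 2 := by
      fin_cases k
      exacts [h1, h2, mul_comm _ _]
    rw [← a.mk_rep, ← b.mk_rep, Projectivization.mk_eq_mk_iff']
    refine ⟨Y a.rep 2 / Y b.rep 2, v.repr.injective (Finsupp.ext fun k => ?_)⟩
    rw [map_smul, Finsupp.smul_apply, hv, hv, smul_eq_mul]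
    refine mul_left_cancel₀ (mul_ne_zero (hc k) hb2) ?_
    have := hk k
    have hdiv : Y b.rep 2 * (Y a.rep 2 / Y b.rep 2) = Y a.rep 2 := mul_div_cancel₀ _ hb2
    generalize Y a.rep 2 / Y b.rep 2 = c at hdiv ⊢
    simp only [Y] at this hdiv ⊢
    linear_combination (conj (d k) * H b.rep (P k)) * hdiv - this
  obtain ⟨l, e0, e1, e2, e3, e4, e5, e6⟩ := proportional_of_infinite_affineCubic
    (hA 0) (hA 1) (hA 2) one_ne_zero (by exact_mod_cast hp) (by exact_mod_cast hp')
    (by exact_mod_cast hp'') (hB.image hφ)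
    (by
      rintro _ ⟨b, hb, rfl⟩
      refine affineCubic_eq_zero (hT hb) (hY0 hb 2) (hY hb 0) (hY hb 1) (hY hb 2) ?_
      rw [← map_add, ← map_add, ← hsum, Complex.mul_conj])
    (g₀ := n 0 0 * Complex.normSq (d 0) + n 1 1 * Complex.normSq (d 1)
      + n 2 2 * Complex.normSq (d 2))
    (by
      rintro _ ⟨b, hb, rfl⟩
      refine hexagon_eq_zero (hT hb) (hY0 hb 2) (hY hb 0) (hY hb 1) (hY hb 2) ?_
      have := hhB b hb
      rw [← LinearMap.comp_apply, apply_eq_sum (H ∘ₗ h) v] at this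
      simp only [Fin.sum_univ_three, LinearMap.comp_apply, hn, hv] at this
      simp only [Y, map_mul, Complex.conj_conj]
      linear_combination this)
  have f1 := mul_right_cancel₀ (hA 0) e1
  have f2 := mul_right_cancel₀ (hA 0) e2
  have f3 := mul_right_cancel₀ (hA 1) e3
  have f4 := mul_right_cancel₀ (hA 1) e4
  have f5 := mul_right_cancel₀ (hA 2) e5
  have f6 := mul_right_cancel₀ (hA 2) e6
  -- All off-diagonal `n i j` equal `l`, and selfadjointness makes `n 0 1` and `n 1 0` conjugate.
  have hl : (l.re : ℂ) = l := by
    rw [← Complex.conj_eq_iff_re]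
    have := hconj 0 1
    rw [hn, hn, f1, f3, map_mul, map_mul, Complex.conj_conj] at this
    refine mul_right_cancel₀ (mul_ne_zero (hd 0) (hc 1)) ?_
    linear_combination this
  have hdiag (k) : ((H (h (v k)) (v k)).re : ℂ) = n k k * Complex.normSq (d k) := by
    rw [Complex.conj_eq_iff_re.mp (hconj k k), hn, ← Complex.mul_conj]
    ring
  -- The term `l ⟨-, p₃⟩ p₃` accounts for the off-diagonal entries of `h`, and `r` corrects the
  -- diagonal. The central coefficient `e0` says exactly that the sum is zero.
  refine ⟨fun k => (H (h (v k)) (v k)).re - l.re * Complex.normSq (d k), l.re, ?_, ?_⟩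
  · rw [← Complex.ofReal_inj]
    push_cast
    simp only [Fin.sum_univ_three, hdiag, hl]
    linear_combination e0
  · refine hH.ext_basis v fun i j => ?_
    have hd4 : H (v i) (∑ k, d k • P k) = conj (d i) := by simp [hvP]
    have hd4' : H (∑ k, d k • P k) (v j) = d j := by simp [hPv]
    simp only [LinearMap.add_apply, LinearMap.sum_apply, ← Complex.coe_smul, LinearMap.smul_apply,
      rankOne_apply, map_add, map_smul, smul_eq_mul, hd4, hd4', hl]
    rw [map_sum, LinearMap.sum_apply]
    simp only [map_smul, LinearMap.smul_apply, smul_eq_mul, hvP, hPv]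
    push_cast
    simp only [hdiag, hl]
    simp only [hn]
    fin_cases i <;> fin_cases j <;>
      simp [f1, f2, f3, f4, f5, f6, ← Complex.mul_conj] <;> ring

/-! ### Rank, focus and curve. -/

/-- If `h = φ(-) w` had rank `1`, zero trace and selfadjointness would make `w` isotropic, and `⟨hn,
n⟩ = 0` would make it orthogonal to the negative `n`, so `w = 0`. -/
theorem HasSignature21.finrank_range_eq_two (hH : HasSignature21 H) {h : V →ₗ[ℂ] V} (h0 : h ≠ 0)
    (hh : H.IsSelfAdjoint h) (htr : LinearMap.trace ℂ V h = 0) (hdet : LinearMap.det h = 0)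
    {n : V} (hn : (H n n).re < 0) (hhn : H (h n) n = 0) :
    Module.finrank ℂ (LinearMap.range h) = 2 := by
  have hV := hH.finrank_eq
  have : FiniteDimensional ℂ V := .of_finrank_pos (by omega)
  have hker := LinearMap.bot_lt_ker_of_det_eq_zero hdet
  have hker' : 0 < Module.finrank ℂ (LinearMap.ker h) := by
    rw [Module.finrank_pos_iff, Submodule.nontrivial_iff_ne_bot]
    exact hker.ne'
  have hrk := h.finrank_range_add_finrank_ker
  have hpos : Module.finrank ℂ (LinearMap.range h) ≠ 0 := by
    rw [Ne, Submodule.finrank_eq_zero, LinearMap.range_eq_bot]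
    exact h0
  suffices Module.finrank ℂ (LinearMap.range h) ≠ 1 by omega
  intro h1
  obtain ⟨e⟩ : Nonempty (LinearMap.range h ≃ₗ[ℂ] ℂ) :=
    FiniteDimensional.nonempty_linearEquiv_of_finrank_eq (by simpa using h1)
  let φ : V →ₗ[ℂ] ℂ := e.toLinearMap ∘ₗ h.rangeRestrict
  let w : V := e.symm 1
  have hφ : h = φ.smulRight w := by
    ext x
    have : e.symm (φ x • 1) = h.rangeRestrict x := by simp [φ]
    rw [map_smul] at this
    exact (congrArg Subtype.val this).symm
  have hsa (x y) : φ x * H w y = conj (φ y) * H x w := by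
    have := hh x y
    simpa [hφ] using this
  have hw : φ w = 0 := by rw [← htr, hφ, LinearMap.trace_smulRight]
  obtain ⟨x, hx⟩ : ∃ x, φ x ≠ 0 := by
    by_contra! hc
    exact h0 (by rw [hφ]; ext x; simp [hc])
  have hww : H w w = 0 := by
    have := hsa x w
    rw [hw, map_zero, zero_mul] at this
    exact (mul_eq_zero.mp this).resolve_left hx
  have hwn : H w n = 0 := by
    have h2 : φ n * H w n = 0 := by simpa [hφ] using hhn
    rcases mul_eq_zero.mp h2 with h2 | h2
    · have := hsa x n
      rw [h2, map_zero, zero_mul] at this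
      exact (mul_eq_zero.mp this).resolve_left hx
    · exact h2
  have := hH.eq_zero_of_isotropic hn hww hwn
  exact h0 (by rw [hφ, this]; ext; simp)

theorem focus_subsingleton {h : V →ₗ[ℂ] V} (hh : Module.finrank ℂ (LinearMap.ker h) = 1) :
    (focus h).Subsingleton := by
  intro a ha b hb
  obtain ⟨c, hc⟩ := exists_smul_eq_of_finrank_eq_one hh
    (x := ⟨b.rep, hb⟩) (fun h => b.rep_nonzero (congrArg Subtype.val h)) ⟨a.rep, ha⟩
  rw [← a.mk_rep, ← b.mk_rep, Projectivization.mk_eq_mk_iff']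
  exact ⟨c, congrArg Subtype.val hc⟩

theorem mk_mem_curve {W : Submodule ℝ (V →ₗ[ℂ] V)} {h : V →ₗ[ℂ] V} (hW : h ∈ W)
    (h0 : (⟨h, hW⟩ : W) ≠ 0) :
    Projectivization.mk ℝ (⟨h, hW⟩ : W) h0 ∈ curve W ↔ LinearMap.det h = 0 := by
  obtain ⟨a, ha⟩ := Projectivization.exists_smul_eq_mk_rep ℝ _ h0
  have ha0 : (a : ℝ) ≠ 0 := a.ne_zero
  simp only [curve, degenerate, Set.mem_ofPred_eq, ← ha, SetLike.coe_mem, true_and, Units.smul_def,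
    Submodule.coe_smul]
  rw [← Complex.coe_smul, LinearMap.det_smul]
  simp [ha0]

end Form

end CHyp

/-! ### The main theorem. -/

theorem theorem1p2p11 {V : Type*} [AddCommGroup V] [Module ℂ V]
    (H : V →ₗ[ℂ] V →ₗ⋆[ℂ] ℂ) (hH : CHyp.HasSignature21 H)
    (W : Submodule ℝ (V →ₗ[ℂ] V))
    (hell : CHyp.IsElliptic H W) (hequ : CHyp.IsEquitant H W)
    (hirr : CHyp.IsIrreducibleCubic W)
    (B : Set (ℙ ℂ V)) (hB : B ⊆ CHyp.base H W) (hinf : B.Infinite) :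
    (W : Set (V →ₗ[ℂ] V)) =
        {h : V →ₗ[ℂ] V | H.IsSelfAdjoint h ∧ ∀ b ∈ B, H (h b.rep) b.rep = 0} ∧
      ∀ h : V →ₗ[ℂ] V, (CHyp.IsBisector H h ∧ B ⊆ CHyp.locus H h) ↔
        ∃ (hW : h ∈ W) (h0 : (⟨h, hW⟩ : W) ≠ 0),
          Projectivization.mk ℝ (⟨h, hW⟩ : W) h0 ∈ CHyp.curve W := by
  have hV := hH.finrank_eq
  have : FiniteDimensional ℂ V := .of_finrank_pos (by omega)
  have part1 : (W : Set (V →ₗ[ℂ] V)) =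
      {h : V →ₗ[ℂ] V | H.IsSelfAdjoint h ∧ ∀ b ∈ B, H (h b.rep) b.rep = 0} := by
    obtain ⟨σ, p, -, -, hgen, -, hW⟩ := hequ
    refine Set.Subset.antisymm (fun h hh => ⟨hell.isFamily.selfAdj h hh, fun b hb => hB hb h hh⟩) ?_
    rintro h ⟨hh, hhB⟩
    let P : Module.Basis (Fin 3) ℂ V := basisOfLinearIndependentOfCardEqFinrank
      (hgen 0 1 2 (by decide) (by decide) (by decide)) (by simp [hV])
    have hP (k : Fin 3) : P k = p k.castSucc := by
      simp only [P, coe_basisOfLinearIndependentOfCardEqFinrank]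
      fin_cases k <;> rfl
    obtain ⟨d, hd⟩ : ∃ d : Fin 3 → ℂ, p 3 = ∑ k, d k • P k := ⟨P.repr (p 3), (P.sum_repr _).symm⟩
    have hd3 : p 3 = d 0 • p 0 + d 1 • p 1 + d 2 • p 2 := by
      rw [hd, Fin.sum_univ_three, hP, hP, hP]
      rfl
    have hd0 (k : Fin 3) : d k ≠ 0 := by
      intro h0
      fin_cases k
      · have := Fintype.linearIndependent_iff.mp
          (hgen 1 2 3 (by decide) (by decide) (by decide)) ![d 1, d 2, -1] (by
            simp only [Fin.isValue, Fin.zero_eta] at h0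
            simp [Fin.sum_univ_three, hd3, h0]
            abel) 2
        simp at this
      · have := Fintype.linearIndependent_iff.mp
          (hgen 0 2 3 (by decide) (by decide) (by decide)) ![d 0, d 2, -1] (by
            simp only [Fin.isValue, Fin.mk_one] at h0
            simp [Fin.sum_univ_three, hd3, h0]
            abel) 2
        simp at this
      · have := Fintype.linearIndependent_iff.mp
          (hgen 0 1 3 (by decide) (by decide) (by decide)) ![d 0, d 1, -1] (by
            simp only [Fin.isValue, Fin.reduceFinMk] at h0
            simp [Fin.sum_univ_three, hd3, h0]
            abel) 2
        simp at this
    have hnf := hirr.not_factor hW P hP hd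
    have hdiff (i : Fin 4) : CHyp.rankOne H (p i) - CHyp.rankOne H (p 3) ∈ W := by
      rw [← SetLike.mem_coe, hW]
      refine ⟨Pi.single i 1 - Pi.single 3 1, by simp, ?_⟩
      simp [sub_smul, Pi.single_apply, Finset.sum_sub_distrib]
    have heq (b) (hb : b ∈ B) (k : Fin 3) : Complex.normSq (H b.rep (P k))
        = Complex.normSq (H b.rep (∑ k, d k • P k)) := by
      have : H ((CHyp.rankOne H (p k.castSucc) - CHyp.rankOne H (p 3)) b.rep) b.rep = 0 :=
        hB hb _ (hdiff k.castSucc)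
      rw [← hd, hP, ← Complex.ofReal_inj, ← Complex.mul_conj, ← Complex.mul_conj, hH.conj_apply,
        hH.conj_apply]
      simpa [CHyp.rankOne_apply, sub_eq_zero] using this
    obtain ⟨r, s, hrs, rfl⟩ := hH.exists_eq_sum_rankOne P hd0
      -- If `A₀ = A₂ = α` and `A₁ = A₃ = 1`, the cubic is `α r₁r₃(r₀ + r₂) + r₀r₂(r₁ + r₃)`, and `r₁
      -- + r₃ = -(r₀ + r₂)`. The other two pairings are alike.
      (fun ⟨h1, h2⟩ => hnf 0 2 1 3 (Complex.normSq (d 0)) 1 fun r hr => by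
        rw [Fin.sum_univ_four] at hr
        obtain hr3 : r 3 = -(r 0 + r 1 + r 2) := by linear_combination hr
        rw [hr3, h2, ← h1]; ring)
      (fun ⟨h1, h2⟩ => hnf 0 1 2 3 (Complex.normSq (d 0)) 1 fun r hr => by
        rw [Fin.sum_univ_four] at hr
        obtain hr3 : r 3 = -(r 0 + r 1 + r 2) := by linear_combination hr
        rw [hr3, h2, ← h1]; ring)
      (fun ⟨h1, h2⟩ => hnf 1 2 0 3 (Complex.normSq (d 1)) 1 fun r hr => by
        rw [Fin.sum_univ_four] at hr
        obtain hr3 : r 3 = -(r 0 + r 1 + r 2) := by linear_combination hr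
        rw [hr3, h1, ← h2]; ring)
      hinf heq hh hhB
    rw [hW]
    have hs : (Fin.snoc r s : Fin 4 → ℝ) 3 = s := Fin.snoc_last (α := fun _ => ℝ) s r
    refine ⟨Fin.snoc r s, ?_, ?_⟩
    · simpa [Fin.sum_univ_castSucc, hs] using hrs
    · rw [← hd, Fin.sum_univ_castSucc (n := 3)]
      simp [hP, hs]
  refine ⟨part1, fun h => ⟨fun ⟨hbis, hBh⟩ => ?_, fun ⟨hW, h0, hcurve⟩ => ?_⟩⟩
  · have hW : h ∈ W := by
      rw [← SetLike.mem_coe, part1]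
      exact ⟨hbis.selfAdj, fun b hb => hBh hb⟩
    have h0 : (⟨h, hW⟩ : W) ≠ 0 := by
      intro h0
      have hz : h = 0 := congrArg Subtype.val h0
      have hrk := hbis.rank_eq
      rw [hz, LinearMap.range_zero, finrank_bot] at hrk
      omega
    refine ⟨hW, h0, (CHyp.mk_mem_curve hW h0).mpr ?_⟩
    by_contra hdet
    have : LinearMap.range h = ⊤ := LinearMap.range_eq_top.mpr
      ((LinearMap.equivOfDetNeZero h hdet).surjective : Function.Surjective h)
    have hrk := hbis.rank_eq
    rw [this, finrank_top, hV] at hrk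
    omega
  · rw [CHyp.mk_mem_curve] at hcurve
    obtain ⟨n, hn, hneg⟩ := hell.isFamily.base_inter_ball
    have hBh : B ⊆ CHyp.locus H h := fun b hb => hB hb h hW
    have hrk := hH.finrank_range_eq_two (fun hz => h0 (Subtype.ext hz))
      (hell.isFamily.selfAdj h hW) (hell.isFamily.trace_eq h hW) hcurve hneg (hn h hW)
    refine ⟨⟨hrk, hell.isFamily.selfAdj h hW, hell.isFamily.trace_eq h hW, fun hfoc => ?_⟩, hBh⟩
    have hker := h.finrank_range_add_finrank_ker
    rw [hrk, hV] at hker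
    -- The kernel is a line, so the focus is at most one point and cannot contain `B`.
    rw [hfoc] at hBh
    exact hinf ((CHyp.focus_subsingleton (Nat.add_left_cancel hker)).finite.subset hBh)
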